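/- Let $G$ be a locally compact (Hausdorff) group and $H$ a closed subgroup of $G$. Suppose that the homogeneous space $G/H$ is amenable in the sense of Eymard and Greenleaf, that is, the space $L^\infty(G/H)$ (bounded Borel functions modulo equality locally almost everywhere with respect to a quasi-invariant nonzero Radon measure on $G/H$) carries a $G$-invariant mean: a positive linear functional $m$ with $m(1)=1$ that is invariant under left translation by every element of $G$. Let $\pi$ be a strongly continuous unitary representation of $G$ in a complex Hilbert space $\mathcal H$. Call a unitary representation $\rho$ of a group $\Gamma$ in $\mathcal H$ amenable in the sense of Bekka if there is a state $\phi$ on the algebra $\mathcal B(\mathcal H)$ of all bounded operators with $\phi(\rho(g)T\rho(g)^{-1})=\phi(T)$ for all $g\in\Gamma$ and $T\in\mathcal B(\mathcal H)$. If the restriction $\pi|_H$ is amenable in the sense of Bekka, then $\pi$ is amenable in the sense of Bekka. -/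

import Mathlib

open MeasureTheory
open scoped ComplexOrder

/-- The space of bounded Borel functions `X → ℂ`. -/
def boundedBorel (X : Type*) [MeasurableSpace X] : Submodule ℂ (X → ℂ) where
  carrier := {f | Measurable f ∧ ∃ C : ℝ, ∀ x, ‖f x‖ ≤ C}
  zero_mem' := ⟨measurable_const, 0, fun x => by simp⟩
  add_mem' := by
    rintro f g ⟨hf, C, hC⟩ ⟨hg, D, hD⟩
    exact ⟨hf.add hg, C + D, fun x => (norm_add_le _ _).trans (add_le_add (hC x) (hD x))⟩
  smul_mem' := by
    rintro c f ⟨hf, C, hC⟩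
    refine ⟨hf.const_smul c, ‖c‖ * C, fun x => ?_⟩
    simpa using mul_le_mul_of_nonneg_left (hC x) (norm_nonneg c)

/-- The constant function `1`. -/
def boundedBorelOne (X : Type*) [MeasurableSpace X] : boundedBorel X :=
  ⟨fun _ => 1, measurable_const, 1, fun _ => by simp⟩

/-- The left translate `x ↦ f (g⁻¹ • x)` of a bounded Borel function. -/
def translateBorel {G X : Type*} [Group G] [MulAction G X] [TopologicalSpace X]
    [ContinuousConstSMul G X] [MeasurableSpace X] [BorelSpace X]
    (g : G) (f : boundedBorel X) : boundedBorel X :=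
  ⟨fun x => (f : X → ℂ) (g⁻¹ • x),
    f.2.1.comp (continuous_const_smul g⁻¹).measurable,
    f.2.2.imp fun _ hC x => hC (g⁻¹ • x)⟩

/-- `A` is locally null for `ν`: it meets every compact set in a `ν`-null set. -/
def IsLocallyNull {X : Type*} [TopologicalSpace X] [MeasurableSpace X]
    (ν : Measure X) (A : Set X) : Prop :=
  ∀ K : Set X, IsCompact K → ν (A ∩ K) = 0

/-- `m` is a `G`-invariant mean on `L^∞(X, ν)`. Here `L^∞(X, ν)` is, as usual on locally compact
spaces which need not be `σ`-compact, the space of bounded Borel functions modulo equality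
outside locally null sets; a functional on it is a functional on `boundedBorel X` which takes
equal values at functions that agree outside a locally null set. -/
structure IsInvariantMean (G : Type*) {X : Type*} [Group G] [MulAction G X] [TopologicalSpace X]
    [ContinuousConstSMul G X] [MeasurableSpace X] [BorelSpace X] (ν : Measure X)
    (m : boundedBorel X →ₗ[ℂ] ℂ) : Prop where
  congr : ∀ f f' : boundedBorel X,
    IsLocallyNull ν {x | (f : X → ℂ) x ≠ (f' : X → ℂ) x} → m f = m f'
  nonneg : ∀ f : boundedBorel X, (∀ x, 0 ≤ (f : X → ℂ) x) → 0 ≤ m f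
  one : m (boundedBorelOne X) = 1
  invariant : ∀ (g : G) (f : boundedBorel X), m (translateBorel g f) = m f

/-- `ν` is a quasi-invariant measure on the `G`-space `X`: a nonzero Radon measure whose
null sets are preserved by the action. -/
structure IsQuasiInvariant (G : Type*) {X : Type*} [Group G] [MulAction G X] [TopologicalSpace X]
    [MeasurableSpace X] (ν : Measure X) : Prop where
  regular : ν.Regular
  ne_zero : ν ≠ 0
  quasi : ∀ g : G, Measure.QuasiMeasurePreserving (fun x : X => g • x) ν ν

/-- Amenability of the homogeneous space `G/H` in the sense of Eymard and Greenleaf: `L^∞(G/H)`,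
formed with respect to a quasi-invariant measure on the Borel sets of `G/H`, carries a
`G`-invariant mean. (All quasi-invariant measures on `G/H` have the same locally null sets.) -/
def IsAmenableHomogeneousSpace {G : Type*} [Group G] [TopologicalSpace G] [IsTopologicalGroup G]
    (H : Subgroup G) : Prop :=
  letI : MeasurableSpace (G ⧸ H) := borel (G ⧸ H)
  haveI : BorelSpace (G ⧸ H) := ⟨rfl⟩
  ∃ ν : Measure (G ⧸ H), IsQuasiInvariant G ν ∧
    ∃ m : boundedBorel (G ⧸ H) →ₗ[ℂ] ℂ, IsInvariantMean G ν m

/-- `φ` is a state on the C⋆-algebra of bounded operators on `E`. -/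
structure IsState {E : Type*} [NormedAddCommGroup E] [InnerProductSpace ℂ E] [CompleteSpace E]
    (φ : (E →L[ℂ] E) →ₗ[ℂ] ℂ) : Prop where
  nonneg : ∀ T : E →L[ℂ] E, 0 ≤ φ (star T * T)
  one : φ 1 = 1

/-- Amenability in the sense of Bekka of a unitary representation. -/
def IsBekkaAmenable {G E : Type*} [Group G] [NormedAddCommGroup E] [InnerProductSpace ℂ E]
    [CompleteSpace E] (π : G →* unitary (E →L[ℂ] E)) : Prop :=
  ∃ φ : (E →L[ℂ] E) →ₗ[ℂ] ℂ, IsState φ ∧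
    ∀ (g : G) (T : E →L[ℂ] E),
      φ ((π g : E →L[ℂ] E) * T * ((π g)⁻¹ : unitary (E →L[ℂ] E))) = φ T

open scoped CompactlySupported Pointwise

/-! Let `φ` be an `H`-invariant state. Ideally one averages `xH ↦ φ(π(x)⁻¹ T π(x))` over `G/H` with
the mean `m`, but for general `T` this function need not be Borel. So `T` is first replaced by
`smear f T`, whose conjugation orbit is norm continuous (`continuous_conjRep_smear`); the function
on `G/H` is then continuous and bounded. The price is a dependence on `f`. For fixed `T ≥ 0`,
invariance of `m` makes the result a positive left-invariant functional of `f`, so by uniqueness of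
Haar measure it sees only `∫ f` (`exists_smearedMean_eq`). Conjugating `T` by `π(g)` amounts to
right translating `f`, up to a scalar that compensates the change in `∫ f`; hence the functional is
invariant (`smearedMean_conjRep`). -/

noncomputable section

/-! ### Translations of test functions and uniqueness of the Haar integral -/

section CompactlySupported

variable {G : Type*} [Group G] [TopologicalSpace G] [IsTopologicalGroup G]

/-- The left translate `x ↦ f (g⁻¹ * x)` of a compactly supported continuous function. -/
def leftTranslate (g : G) (f : C_c(G, ℝ)) : C_c(G, ℝ) where
  toFun x := f (g⁻¹ * x)
  continuous_toFun := f.continuous.comp (continuous_const_mul g⁻¹)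
  hasCompactSupport' := f.hasCompactSupport.comp_homeomorph (Homeomorph.mulLeft g⁻¹)

/-- The right translate `x ↦ f (x * g⁻¹)` of a compactly supported continuous function. -/
def rightTranslate (g : G) (f : C_c(G, ℝ)) : C_c(G, ℝ) where
  toFun x := f (x * g⁻¹)
  continuous_toFun := f.continuous.comp (continuous_mul_const g⁻¹)
  hasCompactSupport' := f.hasCompactSupport.comp_homeomorph (Homeomorph.mulRight g⁻¹)

@[simp] lemma leftTranslate_apply (g : G) (f : C_c(G, ℝ)) (x : G) :
    leftTranslate g f x = f (g⁻¹ * x) := rfl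

@[simp] lemma rightTranslate_apply (g : G) (f : C_c(G, ℝ)) (x : G) :
    rightTranslate g f x = f (x * g⁻¹) := rfl

variable [MeasurableSpace G] [BorelSpace G]

/-- Translation is continuous in `L¹` on compactly supported continuous functions. -/
lemma continuous_integral_abs_leftTranslate_sub [LocallyCompactSpace G] (μ : Measure G)
    [IsFiniteMeasureOnCompacts μ] (f f' : C_c(G, ℝ)) :
    Continuous fun g : G => ∫ x, |(leftTranslate g f - f') x| ∂μ := by
  rw [continuous_iff_continuousAt]
  intro g₀
  obtain ⟨V, hV, hVg⟩ := exists_compact_mem_nhds g₀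
  -- For `g` in the compact neighbourhood `V`, all integrands vanish off one compact set.
  refine (continuousOn_integral_of_compact_support
    (k := V * tsupport f ∪ tsupport f') ?_ ?_ ?_).continuousAt hVg
  · exact (hV.mul f.hasCompactSupport).union f'.hasCompactSupport
  · refine Continuous.continuousOn ?_
    have : Continuous fun p : G × G => |f (p.1⁻¹ * p.2) - f' p.2| :=
      ((f.continuous.comp (continuous_fst.inv.mul continuous_snd)).sub
        (f'.continuous.comp continuous_snd)).abs
    exact this
  · intro g x hg hx
    have h1 : f (g⁻¹ * x) = 0 := by
      refine image_eq_zero_of_notMem_tsupport fun h => hx (Or.inl ?_)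
      exact ⟨g, hg, g⁻¹ * x, h, by simp⟩
    have h2 : f' x = 0 := image_eq_zero_of_notMem_tsupport fun h => hx (Or.inr h)
    simp [h1, h2]

/-- A left-invariant positive functional on compactly supported continuous functions is a
multiple of the Haar integral. -/
lemma exists_eq_mul_integral_of_leftInvariant [LocallyCompactSpace G] [T2Space G]
    (μ : Measure G) [μ.IsHaarMeasure] (L : C_c(G, ℝ) →ₗ[ℝ] ℝ)
    (hpos : ∀ f : C_c(G, ℝ), (∀ x, 0 ≤ f x) → 0 ≤ L f)
    (hinv : ∀ (g : G) (f : C_c(G, ℝ)), L (leftTranslate g f) = L f) :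
    ∃ c : ℝ, ∀ f : C_c(G, ℝ), L f = c * ∫ x, f x ∂μ := by
  let P : C_c(G, ℝ) →ₚ[ℝ] ℝ :=
    { L with
      monotone' := fun f f' h => by
        have := hpos (f' - f) fun x => by simpa using h x
        simpa using this }
  have hP : ∀ f : C_c(G, ℝ), ∫ x, f x ∂(RealRMK.rieszMeasure P) = L f :=
    RealRMK.integral_rieszMeasure P
  set ν := RealRMK.rieszMeasure P with hν
  have : ν.Regular := RealRMK.regular_rieszMeasure P
  have : ν.IsMulLeftInvariant := by
    refine ⟨fun g => ?_⟩
    have : (ν.map (g * ·)).Regular := Measure.Regular.map (Homeomorph.mulLeft g)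
    refine Measure.ext_of_integral_eq_on_compactlySupported fun f => ?_
    have h : ∫ x, f x ∂(ν.map (g * ·)) = ∫ x, f (g * x) ∂ν :=
      (Homeomorph.mulLeft g).measurableEmbedding.integral_map _
    rw [h, hP, ← hinv g⁻¹ f, ← hP]
    simp
  obtain ⟨c, hc⟩ :=
    Measure.exists_integral_isMulLeftInvariant_eq_smul_of_hasCompactSupport ν μ
  refine ⟨c, fun f => ?_⟩
  rw [← hP, hc f f.continuous f.hasCompactSupport, integral_smul_nnreal_measure]
  rfl

end CompactlySupported

/-! ### Conjugation by a unitary representation -/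

section Conj

variable {G E : Type*} [Group G] [NormedAddCommGroup E] [InnerProductSpace ℂ E] [CompleteSpace E]

/-- The action `T ↦ π(g) T π(g)⁻¹` of a group on operators, induced by a unitary
representation. -/
def conjRep (π : G →* unitary (E →L[ℂ] E)) (g : G) : (E →L[ℂ] E) →ₗ[ℂ] (E →L[ℂ] E) where
  toFun T := (π g : E →L[ℂ] E) * T * ((π g)⁻¹ : unitary (E →L[ℂ] E))
  map_add' S T := by rw [mul_add, add_mul]
  map_smul' c T := by rw [mul_smul_comm, smul_mul_assoc, RingHom.id_apply]

variable (π : G →* unitary (E →L[ℂ] E))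

lemma conjRep_def (g : G) (T : E →L[ℂ] E) :
    conjRep π g T = (π g : E →L[ℂ] E) * T * ((π g)⁻¹ : unitary (E →L[ℂ] E)) := rfl

lemma conjRep_apply (g : G) (T : E →L[ℂ] E) (ξ : E) :
    conjRep π g T ξ = (π g : E →L[ℂ] E) (T ((π g⁻¹ : E →L[ℂ] E) ξ)) := by
  rw [conjRep_def, map_inv]
  rfl

lemma conjRep_mul (g h : G) (T : E →L[ℂ] E) :
    conjRep π (g * h) T = conjRep π g (conjRep π h T) := by
  simp [conjRep_def, mul_assoc]

@[simp] lemma conjRep_one_apply (g : G) : conjRep π g 1 = 1 := by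
  rw [conjRep_def, mul_one, ← Submonoid.coe_mul, mul_inv_cancel]
  rfl

lemma norm_unitary_apply (u : unitary (E →L[ℂ] E)) (ξ : E) : ‖(u : E →L[ℂ] E) ξ‖ = ‖ξ‖ :=
  (Unitary.linearIsometryEquiv u).norm_map ξ

lemma norm_conjRep_apply_le (g : G) (T : E →L[ℂ] E) (ξ : E) :
    ‖conjRep π g T ξ‖ ≤ ‖T‖ * ‖ξ‖ := by
  rw [conjRep_apply, norm_unitary_apply]
  refine (T.le_opNorm _).trans_eq ?_
  rw [norm_unitary_apply]

lemma norm_conjRep_le (g : G) (T : E →L[ℂ] E) : ‖conjRep π g T‖ ≤ ‖T‖ :=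
  ContinuousLinearMap.opNorm_le_bound _ (norm_nonneg _) (norm_conjRep_apply_le π g T)

lemma conjRep_nonneg (g : G) {T : E →L[ℂ] E} (hT : 0 ≤ T) : 0 ≤ conjRep π g T := by
  rw [conjRep_def, ← Unitary.star_eq_inv, Unitary.coe_star]
  exact star_right_conjugate_nonneg hT _

variable {π} [TopologicalSpace G]

/-- Unitaries are isometries, so strong continuity upgrades to moving vectors: split `v g = (v g - v
g₀) + v g₀`. -/
lemma continuous_unitary_apply (hπ : ∀ ξ : E, Continuous fun g : G => (π g : E →L[ℂ] E) ξ)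
    {v : G → E} (hv : Continuous v) : Continuous fun g : G => (π g : E →L[ℂ] E) (v g) := by
  rw [continuous_iff_continuousAt]
  intro g₀
  have h1 : Filter.Tendsto (fun g => (π g : E →L[ℂ] E) (v g - v g₀)) (nhds g₀) (nhds 0) := by
    rw [tendsto_zero_iff_norm_tendsto_zero]
    simp_rw [norm_unitary_apply]
    have : Filter.Tendsto (fun g => ‖v g - v g₀‖) (nhds g₀) (nhds ‖v g₀ - v g₀‖) :=
      (hv.sub continuous_const).norm.tendsto g₀
    simpa using this
  have h2 := h1.add ((hπ (v g₀)).tendsto g₀)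
  simpa [ContinuousAt] using h2

lemma continuous_conjRep_apply [IsTopologicalGroup G]
    (hπ : ∀ ξ : E, Continuous fun g : G => (π g : E →L[ℂ] E) ξ)
    (T : E →L[ℂ] E) (ξ : E) : Continuous fun g : G => conjRep π g T ξ := by
  simp_rw [conjRep_apply]
  exact continuous_unitary_apply hπ (T.continuous.comp ((hπ ξ).comp continuous_inv))

end Conj

/-! ### Positivity and automatic continuity of states -/

section State

variable {E : Type*} [NormedAddCommGroup E] [InnerProductSpace ℂ E] [CompleteSpace E]

lemma IsState.apply_nonneg {φ : (E →L[ℂ] E) →ₗ[ℂ] ℂ} (hφ : IsState φ) {T : E →L[ℂ] E}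
    (hT : 0 ≤ T) : 0 ≤ φ T := by
  obtain ⟨S, rfl⟩ := CStarAlgebra.nonneg_iff_eq_star_mul_self.mp hT
  exact hφ.nonneg S

lemma IsState.continuous {φ : (E →L[ℂ] E) →ₗ[ℂ] ℂ} (hφ : IsState φ) : Continuous φ := by
  let P : (E →L[ℂ] E) →ₚ[ℂ] ℂ :=
    { φ with
      monotone' := fun S T h => by
        have := hφ.apply_nonneg (sub_nonneg.mpr h)
        rw [map_sub] at this
        exact sub_nonneg.mp this }
  exact map_continuous P

end State

/-! ### Smearing an operator over its conjugation orbit -/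

section Smear

variable {G E : Type*} [Group G] [TopologicalSpace G] [IsTopologicalGroup G]
  [MeasurableSpace G] [BorelSpace G]
  [NormedAddCommGroup E] [InnerProductSpace ℂ E] [CompleteSpace E]
  {π : G →* unitary (E →L[ℂ] E)} (hπ : ∀ ξ : E, Continuous fun g : G => (π g : E →L[ℂ] E) ξ)
  (μ : Measure G) [IsFiniteMeasureOnCompacts μ]

omit [InnerProductSpace ℂ E] [CompleteSpace E] [IsTopologicalGroup G] [Group G] in
lemma integrable_smul_of_continuous [NormedSpace ℝ E] (f : C_c(G, ℝ)) {v : G → E}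
    (hv : Continuous v) : Integrable (fun x => f x • v x) μ :=
  (f.continuous.smul hv).integrable_of_hasCompactSupport f.hasCompactSupport.smul_right

include hπ in
lemma integrable_smul_conjRep_apply (f : C_c(G, ℝ)) (T : E →L[ℂ] E) (ξ : E) :
    Integrable (fun x => f x • conjRep π x T ξ) μ :=
  integrable_smul_of_continuous μ f (continuous_conjRep_apply hπ T ξ)

omit [IsTopologicalGroup G] in
lemma norm_integral_smul_conjRep_apply_le (f : C_c(G, ℝ)) (T : E →L[ℂ] E) (ξ : E) :
    ‖∫ x, f x • conjRep π x T ξ ∂μ‖ ≤ (∫ x, |f x| ∂μ) * ‖T‖ * ‖ξ‖ := by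
  rw [mul_assoc, ← integral_mul_const]
  refine norm_integral_le_of_norm_le ?_ (Filter.Eventually.of_forall fun x => ?_)
  · exact (f.continuous.abs.integrable_of_hasCompactSupport
      (f.hasCompactSupport.comp_left abs_zero)).mul_const _
  · rw [norm_smul, Real.norm_eq_abs]
    exact mul_le_mul_of_nonneg_left (norm_conjRep_apply_le π x T ξ) (abs_nonneg _)

/-- The operator `∫ f(x) π(x) T π(x)⁻¹ dμ(x)`, the integral being taken in the strong sense. -/
def smear (f : C_c(G, ℝ)) (T : E →L[ℂ] E) : E →L[ℂ] E :=
  LinearMap.mkContinuous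
    { toFun := fun ξ => ∫ x, f x • conjRep π x T ξ ∂μ
      map_add' := fun ξ η => by
        simp_rw [map_add, smul_add]
        exact integral_add (integrable_smul_conjRep_apply hπ μ f T ξ)
          (integrable_smul_conjRep_apply hπ μ f T η)
      map_smul' := fun c ξ => by
        simp_rw [map_smul, smul_comm _ c]
        exact integral_smul c _ }
    ((∫ x, |f x| ∂μ) * ‖T‖) (norm_integral_smul_conjRep_apply_le μ f T)

lemma smear_apply (f : C_c(G, ℝ)) (T : E →L[ℂ] E) (ξ : E) :
    smear hπ μ f T ξ = ∫ x, f x • conjRep π x T ξ ∂μ := rfl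

lemma norm_smear_le (f : C_c(G, ℝ)) (T : E →L[ℂ] E) :
    ‖smear hπ μ f T‖ ≤ (∫ x, |f x| ∂μ) * ‖T‖ :=
  LinearMap.mkContinuous_norm_le _
    (mul_nonneg (integral_nonneg fun _ => abs_nonneg _) (norm_nonneg _)) _

lemma smear_add (f : C_c(G, ℝ)) (S T : E →L[ℂ] E) :
    smear hπ μ f (S + T) = smear hπ μ f S + smear hπ μ f T := by
  ext ξ
  simp only [smear_apply, _root_.add_apply, map_add, smul_add]
  exact integral_add (integrable_smul_conjRep_apply hπ μ f S ξ)
    (integrable_smul_conjRep_apply hπ μ f T ξ)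

lemma smear_smul (f : C_c(G, ℝ)) (c : ℂ) (T : E →L[ℂ] E) :
    smear hπ μ f (c • T) = c • smear hπ μ f T := by
  ext ξ
  simp only [smear_apply, _root_.smul_apply, map_smul, smul_comm _ c]
  exact integral_smul c _

lemma add_smear (f f' : C_c(G, ℝ)) (T : E →L[ℂ] E) :
    smear hπ μ (f + f') T = smear hπ μ f T + smear hπ μ f' T := by
  ext ξ
  simp only [smear_apply, _root_.add_apply, CompactlySupportedContinuousMap.add_apply,
    add_smul]
  exact integral_add (integrable_smul_conjRep_apply hπ μ f T ξ)
    (integrable_smul_conjRep_apply hπ μ f' T ξ)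

lemma smul_smear (c : ℝ) (f : C_c(G, ℝ)) (T : E →L[ℂ] E) :
    smear hπ μ (c • f) T = (c : ℂ) • smear hπ μ f T := by
  ext ξ
  simp only [smear_apply, _root_.smul_apply, CompactlySupportedContinuousMap.smul_apply,
    smul_assoc, Complex.coe_smul]
  exact integral_smul c _

lemma sub_smear (f f' : C_c(G, ℝ)) (T : E →L[ℂ] E) :
    smear hπ μ (f - f') T = smear hπ μ f T - smear hπ μ f' T := by
  rw [eq_sub_iff_add_eq, ← add_smear, sub_add_cancel]

lemma smear_one (f : C_c(G, ℝ)) : smear hπ μ f 1 = ((∫ x, f x ∂μ : ℝ) : ℂ) • 1 := by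
  ext ξ
  rw [smear_apply]
  simp only [conjRep_one_apply]
  rw [integral_smul_const]
  simp

/-- The quadratic form of the smeared operator is the integral of `f` times the nonnegative
quadratic forms of the conjugates. -/
lemma smear_nonneg {f : C_c(G, ℝ)} (hf : ∀ x, 0 ≤ f x) {T : E →L[ℂ] E} (hT : 0 ≤ T) :
    0 ≤ smear hπ μ f T := by
  rw [ContinuousLinearMap.nonneg_iff_isPositive, ContinuousLinearMap.isPositive_iff_complex]
  intro ξ
  have h : inner ℂ (smear hπ μ f T ξ) ξ
      = ((∫ x, f x * (inner ℂ (conjRep π x T ξ) ξ).re ∂μ : ℝ) : ℂ) := by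
    have h1 := integral_inner (𝕜 := ℂ) (integrable_smul_conjRep_apply hπ μ f T ξ) ξ
    rw [smear_apply, ← inner_conj_symm, ← h1, ← integral_conj, ← integral_complex_ofReal]
    refine integral_congr_ae (Filter.Eventually.of_forall fun x => ?_)
    have hpos := ((ContinuousLinearMap.nonneg_iff_isPositive _).mp
      (conjRep_nonneg π x hT))
    have := ((ContinuousLinearMap.isPositive_iff_complex _).mp hpos ξ).1
    simp only [inner_conj_symm]
    rw [← Complex.coe_smul, inner_smul_left, ← this]
    simp
  rw [h]
  refine ⟨by simp, ?_⟩
  simp only [RCLike.re_to_complex, Complex.ofReal_re]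
  refine integral_nonneg fun x => mul_nonneg (hf x) ?_
  exact ((ContinuousLinearMap.isPositive_iff_complex _).mp
    ((ContinuousLinearMap.nonneg_iff_isPositive _).mp (conjRep_nonneg π x hT)) ξ).2

lemma conjRep_smear [μ.IsMulLeftInvariant] (g : G) (f : C_c(G, ℝ)) (T : E →L[ℂ] E) :
    conjRep π g (smear hπ μ f T) = smear hπ μ (leftTranslate g f) T := by
  ext ξ
  rw [conjRep_apply, smear_apply, smear_apply, ← ContinuousLinearMap.integral_comp_comm _
    (integrable_smul_conjRep_apply hπ μ f T _),
    ← integral_mul_left_eq_self (fun x => leftTranslate g f x • conjRep π x T ξ) g]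
  congr 1
  ext x
  rw [conjRep_mul, conjRep_apply π g]
  simp only [leftTranslate_apply, inv_mul_cancel_left]
  rw [← Complex.coe_smul, map_smul, Complex.coe_smul]

/-- Substituting `x ↦ x * g⁻¹` rescales Haar measure. What matters is that `c` depends on neither
`f` nor `T`, so that it can later be read off from `T = 1`. -/
lemma exists_smear_conjRep [LocallyCompactSpace G] (μ : Measure G) [μ.IsHaarMeasure] [μ.Regular]
    (g : G) :
    ∃ c : ℂ, ∀ (f : C_c(G, ℝ)) (T : E →L[ℂ] E),
      smear hπ μ f (conjRep π g T) = c • smear hπ μ (rightTranslate g f) T := by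
  have : (μ.map (· * g)).Regular := Measure.Regular.map (Homeomorph.mulRight g)
  refine ⟨((μ.map (· * g)).haarScalarFactor μ : ℝ), fun f T => ?_⟩
  ext ξ
  have h : ∫ x, rightTranslate g f x • conjRep π x T ξ ∂(μ.map (· * g))
      = ∫ x, rightTranslate g f (x * g) • conjRep π (x * g) T ξ ∂μ :=
    (Homeomorph.mulRight g).measurableEmbedding.integral_map _
  rw [Measure.isMulLeftInvariant_eq_smul_of_regular (μ.map (· * g)) μ,
    integral_smul_nnreal_measure] at h
  rw [_root_.smul_apply, smear_apply, smear_apply, Complex.coe_smul]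
  refine Eq.trans ?_ h.symm
  simp [conjRep_mul]

/-- Conjugation moves onto `f` as a left translation, and the operator norm is bounded by the `L¹`
norm of the weight; continuity of translation in `L¹` concludes. -/
lemma continuous_conjRep_smear [LocallyCompactSpace G] [μ.IsMulLeftInvariant] (f : C_c(G, ℝ))
    (T : E →L[ℂ] E) : Continuous fun g : G => conjRep π g (smear hπ μ f T) := by
  rw [continuous_iff_continuousAt]
  intro g₀
  rw [ContinuousAt, tendsto_iff_norm_sub_tendsto_zero]
  simp_rw [conjRep_smear, ← sub_smear]
  have h := ((continuous_integral_abs_leftTranslate_sub μ f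
    (leftTranslate g₀ f)).mul_const ‖T‖).tendsto g₀
  simp only [sub_self, CompactlySupportedContinuousMap.zero_apply, abs_zero, integral_zero,
    zero_mul] at h
  exact squeeze_zero (fun _ => norm_nonneg _) (fun g => norm_smear_le hπ μ _ T) h

end Smear

/-! ### Orbit functions on `G/H` -/

section CosetOrbit

variable {G E : Type*} [Group G] [NormedAddCommGroup E] [InnerProductSpace ℂ E] [CompleteSpace E]
  {π : G →* unitary (E →L[ℂ] E)} {H : Subgroup G} {φ : (E →L[ℂ] E) →ₗ[ℂ] ℂ}
  (hinv : ∀ h ∈ H, ∀ T : E →L[ℂ] E, φ (conjRep π h T) = φ T)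

/-- The function `xH ↦ φ(π(x)⁻¹ S π(x))` on `G/H`, for an `H`-invariant functional `φ`. -/
def cosetOrbit (S : E →L[ℂ] E) : G ⧸ H → ℂ :=
  Quotient.lift (fun x : G => φ (conjRep π x⁻¹ S)) fun a b hab => by
    have h : a⁻¹ * b ∈ H := QuotientGroup.leftRel_apply.mp hab
    have := hinv _ (H.inv_mem h) (conjRep π a⁻¹ S)
    rw [← conjRep_mul] at this
    simpa using this.symm

@[simp] lemma cosetOrbit_mk (S : E →L[ℂ] E) (x : G) :
    cosetOrbit hinv S (x : G ⧸ H) = φ (conjRep π x⁻¹ S) := rfl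

lemma cosetOrbit_add (S T : E →L[ℂ] E) :
    cosetOrbit hinv (S + T) = cosetOrbit hinv S + cosetOrbit hinv T := by
  ext x
  induction x using QuotientGroup.induction_on with
  | H x => simp

lemma cosetOrbit_smul (c : ℂ) (S : E →L[ℂ] E) :
    cosetOrbit hinv (c • S) = c • cosetOrbit hinv S := by
  ext x
  induction x using QuotientGroup.induction_on with
  | H x => simp

lemma cosetOrbit_one (hφ : IsState φ) : cosetOrbit hinv (1 : E →L[ℂ] E) = fun _ => 1 := by
  ext x
  induction x using QuotientGroup.induction_on with
  | H x => simp [hφ.one]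

lemma cosetOrbit_nonneg (hφ : IsState φ) {S : E →L[ℂ] E} (hS : 0 ≤ S) (x : G ⧸ H) :
    0 ≤ cosetOrbit hinv S x := by
  induction x using QuotientGroup.induction_on with
  | H x => exact hφ.apply_nonneg (conjRep_nonneg π _ hS)

lemma cosetOrbit_conjRep (g : G) (S : E →L[ℂ] E) (x : G ⧸ H) :
    cosetOrbit hinv (conjRep π g S) x = cosetOrbit hinv S (g⁻¹ • x) := by
  induction x using QuotientGroup.induction_on with
  | H x =>
    rw [← QuotientGroup.mk_mul_of_mem _ H.one_mem, mul_one, MulAction.Quotient.smul_mk,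
      cosetOrbit_mk, cosetOrbit_mk, ← conjRep_mul]
    simp

lemma exists_norm_cosetOrbit_le (hφ : IsState φ) (S : E →L[ℂ] E) :
    ∃ C : ℝ, ∀ x : G ⧸ H, ‖cosetOrbit hinv S x‖ ≤ C := by
  let ψ : (E →L[ℂ] E) →L[ℂ] ℂ := ⟨φ, hφ.continuous⟩
  refine ⟨‖ψ‖ * ‖S‖, fun x => ?_⟩
  induction x using QuotientGroup.induction_on with
  | H x =>
    exact (ψ.le_opNorm _).trans
      (mul_le_mul_of_nonneg_left (norm_conjRep_le π _ S) (norm_nonneg ψ))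

lemma continuous_cosetOrbit [TopologicalSpace G] [IsTopologicalGroup G] (hφ : IsState φ)
    {S : E →L[ℂ] E} (hS : Continuous fun g : G => conjRep π g S) :
    Continuous (cosetOrbit hinv S) :=
  Continuous.quotient_lift (hφ.continuous.comp (hS.comp continuous_inv)) _

end CosetOrbit

/-! ### Averaging orbit functions with the invariant mean -/

section Mean

variable {G E : Type*} [Group G] [TopologicalSpace G] [IsTopologicalGroup G]
  [LocallyCompactSpace G] [MeasurableSpace G] [BorelSpace G]
  [NormedAddCommGroup E] [InnerProductSpace ℂ E] [CompleteSpace E]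
  {π : G →* unitary (E →L[ℂ] E)} (hπ : ∀ ξ : E, Continuous fun g : G => (π g : E →L[ℂ] E) ξ)
  {H : Subgroup G} [MeasurableSpace (G ⧸ H)] [BorelSpace (G ⧸ H)]
  {φ : (E →L[ℂ] E) →ₗ[ℂ] ℂ} (hφ : IsState φ)
  (hinv : ∀ h ∈ H, ∀ T : E →L[ℂ] E, φ (conjRep π h T) = φ T)
  (μ : Measure G) [μ.IsHaarMeasure]

/-- The function `xH ↦ φ(π(x)⁻¹ S π(x))` on `G/H` as a bounded Borel function, where `S` is the
operator `∫ f(x) π(x) T π(x)⁻¹ dμ(x)`. -/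
def smearedOrbit (f : C_c(G, ℝ)) (T : E →L[ℂ] E) : boundedBorel (G ⧸ H) :=
  ⟨cosetOrbit hinv (smear hπ μ f T),
    (continuous_cosetOrbit hinv hφ (continuous_conjRep_smear hπ μ f T)).measurable,
    exists_norm_cosetOrbit_le hinv hφ _⟩

variable (m : boundedBorel (G ⧸ H) →ₗ[ℂ] ℂ)

/-- The linear functional `T ↦ m(xH ↦ φ(π(x)⁻¹ S π(x)))`, where `S` is the operator
`∫ f(x) π(x) T π(x)⁻¹ dμ(x)`. -/
def smearedMean (f : C_c(G, ℝ)) : (E →L[ℂ] E) →ₗ[ℂ] ℂ where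
  toFun T := m (smearedOrbit hπ hφ hinv μ f T)
  map_add' S T := by
    rw [← map_add]
    congr 1
    exact Subtype.ext (by simp [smearedOrbit, smear_add, cosetOrbit_add])
  map_smul' c T := by
    rw [RingHom.id_apply, ← map_smul]
    congr 1
    exact Subtype.ext (by simp [smearedOrbit, smear_smul, cosetOrbit_smul])

lemma smearedMean_apply (f : C_c(G, ℝ)) (T : E →L[ℂ] E) :
    smearedMean hπ hφ hinv μ m f T = m (smearedOrbit hπ hφ hinv μ f T) := rfl

lemma smearedMean_add (f f' : C_c(G, ℝ)) (T : E →L[ℂ] E) :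
    smearedMean hπ hφ hinv μ m (f + f') T
      = smearedMean hπ hφ hinv μ m f T + smearedMean hπ hφ hinv μ m f' T := by
  simp only [smearedMean_apply]
  rw [← map_add]
  congr 1
  exact Subtype.ext (by simp [smearedOrbit, add_smear, cosetOrbit_add])

lemma smearedMean_smul (c : ℝ) (f : C_c(G, ℝ)) (T : E →L[ℂ] E) :
    smearedMean hπ hφ hinv μ m (c • f) T = c * smearedMean hπ hφ hinv μ m f T := by
  simp only [smearedMean_apply]
  rw [← smul_eq_mul, ← map_smul]
  congr 1
  exact Subtype.ext (by
    simp only [smearedOrbit, smul_smear, cosetOrbit_smul]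
    rfl)

variable {ν : Measure (G ⧸ H)} {m} (hm : IsInvariantMean G ν m)

include hm

lemma smearedMean_nonneg {f : C_c(G, ℝ)} (hf : ∀ x, 0 ≤ f x) {T : E →L[ℂ] E} (hT : 0 ≤ T) :
    0 ≤ smearedMean hπ hφ hinv μ m f T :=
  hm.nonneg _ fun x => cosetOrbit_nonneg hinv hφ (smear_nonneg hπ μ hf hT) x

lemma smearedMean_one (f : C_c(G, ℝ)) :
    smearedMean hπ hφ hinv μ m f 1 = (∫ x, f x ∂μ : ℝ) := by
  have h : smearedOrbit hπ hφ hinv μ f 1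
      = ((∫ x, f x ∂μ : ℝ) : ℂ) • boundedBorelOne (G ⧸ H) :=
    Subtype.ext (by
      simp only [smearedOrbit, smear_one, cosetOrbit_smul, cosetOrbit_one hinv hφ]
      rfl)
  rw [smearedMean_apply, h, map_smul, hm.one, smul_eq_mul, mul_one]

lemma smearedMean_leftTranslate (g : G) (f : C_c(G, ℝ)) (T : E →L[ℂ] E) :
    smearedMean hπ hφ hinv μ m (leftTranslate g f) T = smearedMean hπ hφ hinv μ m f T := by
  rw [smearedMean_apply, smearedMean_apply, ← hm.invariant g (smearedOrbit hπ hφ hinv μ f T)]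
  congr 1
  refine Subtype.ext (funext fun x => ?_)
  simp only [smearedOrbit, translateBorel, ← conjRep_smear, cosetOrbit_conjRep]

lemma exists_smearedMean_eq [T2Space G] {T : E →L[ℂ] E} (hT : 0 ≤ T) :
    ∃ c : ℂ, ∀ f : C_c(G, ℝ), smearedMean hπ hφ hinv μ m f T = c * (∫ x, f x ∂μ : ℝ) := by
  let L : (ℂ →ₗ[ℝ] ℝ) → C_c(G, ℝ) →ₗ[ℝ] ℝ := fun p => p ∘ₗ
    { toFun := fun f => smearedMean hπ hφ hinv μ m f T
      map_add' := fun f f' => smearedMean_add hπ hφ hinv μ m f f' T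
      map_smul' := fun c f => by
        rw [smearedMean_smul, RingHom.id_apply, Complex.real_smul] }
  -- Haar uniqueness is available for real functionals, so it is applied to real and imaginary
  -- parts; both are nonnegative on `0 ≤ z`.
  have hL : ∀ p : ℂ →ₗ[ℝ] ℝ, (∀ z, 0 ≤ z → 0 ≤ p z) →
      ∃ c : ℝ, ∀ f : C_c(G, ℝ), p (smearedMean hπ hφ hinv μ m f T) = c * ∫ x, f x ∂μ :=
    fun p hp => exists_eq_mul_integral_of_leftInvariant μ (L p)
      (fun f hf => hp _ (smearedMean_nonneg hπ hφ hinv μ hm hf hT))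
      (fun g f => congrArg p (smearedMean_leftTranslate hπ hφ hinv μ hm g f T))
  obtain ⟨a, ha⟩ := hL Complex.reLm fun z hz => (Complex.nonneg_iff.mp hz).1
  obtain ⟨b, hb⟩ := hL Complex.imLm fun z hz => (Complex.nonneg_iff.mp hz).2.le
  refine ⟨⟨a, b⟩, fun f => Complex.ext ?_ ?_⟩
  · simpa using ha f
  · simpa using hb f

lemma smearedMean_conjRep [T2Space G] [μ.Regular] (g : G) (f : C_c(G, ℝ)) (T : E →L[ℂ] E) :
    smearedMean hπ hφ hinv μ m f (conjRep π g T) = smearedMean hπ hφ hinv μ m f T := by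
  obtain ⟨c, hc⟩ := exists_smear_conjRep hπ μ g
  have hsm : ∀ S : E →L[ℂ] E, smearedMean hπ hφ hinv μ m f (conjRep π g S)
      = c * smearedMean hπ hφ hinv μ m (rightTranslate g f) S := fun S => by
    rw [smearedMean_apply, smearedMean_apply, ← smul_eq_mul, ← map_smul]
    congr 1
    exact Subtype.ext (by
      simp only [smearedOrbit, hc, cosetOrbit_smul]
      rfl)
  -- The case `S = 1` shows that `c` exactly cancels the change of integral under right translation.
  have h1 : ((∫ x, f x ∂μ : ℝ) : ℂ) = c * (∫ x, rightTranslate g f x ∂μ : ℝ) := by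
    have := hsm 1
    rwa [conjRep_one_apply, smearedMean_one hπ hφ hinv μ hm,
      smearedMean_one hπ hφ hinv μ hm] at this
  -- Proportionality to `∫ f` is known only for positive operators; these span.
  have hT : T ∈ Submodule.span ℂ {a : E →L[ℂ] E | 0 ≤ a} := by
    rw [CStarAlgebra.span_nonneg]
    trivial
  induction hT using Submodule.span_induction with
  | mem S hS =>
    obtain ⟨d, hd⟩ := exists_smearedMean_eq hπ hφ hinv μ hm hS
    rw [hsm, hd, hd, h1]
    ring
  | zero => simp
  | add S T _ _ hS hT => rw [map_add, map_add, map_add, hS, hT]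
  | smul a S _ hS => rw [map_smul, map_smul, map_smul, hS]

end Mean

/-! ### Normalised weight and conclusion -/

/-- There is a nonnegative compactly supported continuous function of integral `1`. -/
lemma exists_nonneg_integral_eq_one {G : Type*} [Group G] [TopologicalSpace G]
    [IsTopologicalGroup G] [LocallyCompactSpace G] [MeasurableSpace G] [BorelSpace G]
    (μ : Measure G) [μ.IsHaarMeasure] :
    ∃ f : C_c(G, ℝ), (∀ x, 0 ≤ f x) ∧ ∫ x, f x ∂μ = 1 := by
  obtain ⟨g, g_comp, g_nonneg, g_one⟩ :
    ∃ g : C(G, ℝ), HasCompactSupport g ∧ 0 ≤ g ∧ g 1 ≠ 0 := exists_continuous_nonneg_pos 1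
  have hpos : 0 < ∫ x, g x ∂μ :=
    g.continuous.integral_pos_of_hasCompactSupport_nonneg_nonzero g_comp g_nonneg g_one
  let g' : C_c(G, ℝ) := ⟨g, g_comp⟩
  refine ⟨(∫ x, g x ∂μ)⁻¹ • g', fun x => ?_, ?_⟩
  · exact mul_nonneg (inv_nonneg.mpr hpos.le) (g_nonneg x)
  · have : ∫ x, ((∫ x, g x ∂μ)⁻¹ • g') x ∂μ = (∫ x, g x ∂μ)⁻¹ * ∫ x, g x ∂μ :=
      integral_const_mul _ _
    rw [this, inv_mul_cancel₀ hpos.ne']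

end

theorem mainTheorem4 {G E : Type*} [Group G] [TopologicalSpace G] [IsTopologicalGroup G]
    [LocallyCompactSpace G] [T2Space G]
    [NormedAddCommGroup E] [InnerProductSpace ℂ E] [CompleteSpace E]
    (H : Subgroup G) (hH : IsClosed (H : Set G))
    (hGH : IsAmenableHomogeneousSpace H)
    (π : G →* unitary (E →L[ℂ] E))
    (hπ : ∀ ξ : E, Continuous fun g : G => (π g : E →L[ℂ] E) ξ)
    (hres : IsBekkaAmenable (π.comp H.subtype)) :
    IsBekkaAmenable π := by
  let : MeasurableSpace (G ⧸ H) := borel (G ⧸ H)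
  have : BorelSpace (G ⧸ H) := ⟨rfl⟩
  obtain ⟨ν, -, m, hm⟩ := hGH
  obtain ⟨φ, hφ, hφH⟩ := hres
  have hinv : ∀ h ∈ H, ∀ T : E →L[ℂ] E, φ (conjRep π h T) = φ T :=
    fun h hh T => hφH ⟨h, hh⟩ T
  borelize G
  obtain ⟨f, hf, hf1⟩ := exists_nonneg_integral_eq_one (Measure.haar : Measure G)
  -- `f ≥ 0` gives positivity and `∫ f = 1` gives the value `1` at the identity.
  refine ⟨smearedMean hπ hφ hinv Measure.haar m f, ⟨fun T => ?_, ?_⟩, fun g T => ?_⟩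
  · exact smearedMean_nonneg hπ hφ hinv _ hm hf (star_mul_self_nonneg T)
  · rw [smearedMean_one hπ hφ hinv _ hm, hf1, Complex.ofReal_one]
  · exact smearedMean_conjRep hπ hφ hinv _ hm g f T
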